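/- **Setting.** Fix an infinite set $\mathbf{C}$ of constants. A schema is a finite set of relation names with arities $\ge 0$. A Datalog rule $R_0(\bar x_0) \text{ :- } R_1(\bar x_1),\ldots,R_n(\bar x_n)$, $n\ge 1$, has constant-free atoms, and each variable of $\bar x_0$ occurs in its body. A Datalog program $\Sigma$ is a finite set of such rules. A predicate occurring in $\Sigma$ is intensional if it occurs in the head of some rule, and extensional otherwise. A Datalog query is a pair $Q=(\Sigma,R)$ with $R$ an intensional predicate of $\Sigma$. It is non-recursive if the predicate graph of $\Sigma$, which has an edge from $P$ to $P'$ whenever $P$ occurs in the body of a rule with head predicate $P'$, has no directed cycle. A database $D$ over the extensional schema is a finite set of facts with extensional predicates, and $\mathrm{adom}(D)$ is the set of constants occurring in $D$. A proof tree of a fact $\alpha$ w.r.t. $D$ and $\Sigma$ is a finite rooted tree, with nodes labeled by facts over the predicates of $\Sigma$ and the constants of $\mathrm{adom}(D)$, such that the root is labeled $\alpha$, each leaf is labeled by a fact of $D$, and each inner node together with its children is an instance of a rule of $\Sigma$ (the label of the node is the image of the head, and the labels of the children are the images of the body atoms, under one substitution of constants for variables). It is non-recursive if no node has the same label as one of its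 proper descendants. Its support is the set of the labels of its leaves. For $\bar t\in\mathrm{adom}(D)^{\mathrm{ar}(R)}$, let $\mathrm{why}_{\mathrm{NR}}(\bar t,D,Q)$ be the family of the supports of all non-recursive proof trees of $R(\bar t)$ w.r.t. $D$ and $\Sigma$. For a fixed query $Q$, the problem $\mathsf{Why\text{-}Provenance}_{\mathrm{NR}}[Q]$ is: given a database $D$ over the extensional schema of $\Sigma$, a tuple $\bar t\in\mathrm{adom}(D)^{\mathrm{ar}(R)}$ and $D'\subseteq D$, is $D'\in \mathrm{why}_{\mathrm{NR}}(\bar t,D,Q)$? **Theorem.** For every non-recursive Datalog query $Q$, the problem $\mathsf{Why\text{-}Provenance}_{\mathrm{NR}}[Q]$ is in $\mathrm{AC}_0$. In other words, why-provenance relative to non-recursive proof trees is, for non-recursive Datalog queries, in $\mathrm{AC}_0$ in data complexity. Here inputs are encoded in the standard way. With the constants of $\mathrm{adom}(D)$ numbered $0,\ldots,N-1$ in any order, there is one bit for each possible fact telling whether it is in $D$, one telling whether it is in $D'$, and one bit for each position $i$ and each constant $c$ telling whether $t_i=c$. Being in $\mathrm{AC}_0$ means that there is a family $(K_N)_{N\ge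 0}$ of Boolean circuits with unbounded fan-in, of constant depth and of size polynomial in $N$, which is first-order uniform (gates are named by tuples over $\{0,\ldots,N-1\}$, of finitely many sorts, and the gate types, the input bits read, the wires and the output gate are definable by first-order formulas over $\{\le,\mathrm{BIT}\}$ that do not depend on $N$), such that $K_N$ accepts a bit vector if and only if it encodes an input with $|\mathrm{adom}(D)|=N$ whose answer is yes. -/

import Mathlib

/-! ### Relational schemas, atoms, databases -/

/-- A relational schema: a finite set of relation names, each with an arity (possibly `0`). -/
structure Schema where
  Rel : Type
  arity : Rel → ℕ
  finite : Finite Rel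

/-- An atom `R(t₁, …, tₙ)` over a schema, with terms from `T`. -/
structure RelAtom (S : Schema) (T : Type*) where
  rel : S.Rel
  args : Fin (S.arity rel) → T

/-- Apply a map to all terms of an atom. -/
def RelAtom.map {S : Schema} {T U : Type*} (h : T → U) (α : RelAtom S T) : RelAtom S U :=
  ⟨α.rel, fun i => h (α.args i)⟩

/-- The active domain: all terms that occur in a set of atoms. -/
def activeDomain {S : Schema} {T : Type*} (D : Set (RelAtom S T)) : Set T :=
  {c | ∃ α ∈ D, ∃ i, α.args i = c}

/-! ### Datalog programs and queries -/

/-- A Datalog rule `R₀(x₀) :- R₁(x₁), …, Rₙ(xₙ)` with `n ≥ 1`, without constants, and such that each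
variable of the head occurs in the body. Variables are natural numbers. -/
structure DatalogRule (S : Schema) where
  head : RelAtom S ℕ
  body : List (RelAtom S ℕ)
  body_ne_nil : body ≠ []
  safe : ∀ i, ∃ α ∈ body, ∃ j, α.args j = head.args i

/-- A Datalog program: a finite set of Datalog rules. -/
abbrev DatalogProgram (S : Schema) := Finset (DatalogRule S)

namespace DatalogProgram

variable {S : Schema}

/-- `P` is intensional: it occurs in the head of some rule. -/
def Intensional (Sig : DatalogProgram S) (P : S.Rel) : Prop :=
  ∃ r ∈ Sig, r.head.rel = P

/-- `P` occurs in some rule of the program. -/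
def Occurs (Sig : DatalogProgram S) (P : S.Rel) : Prop :=
  ∃ r ∈ Sig, r.head.rel = P ∨ ∃ α ∈ r.body, α.rel = P

/-- `P` is extensional: it occurs in the program, but in the head of no rule. -/
def Extensional (Sig : DatalogProgram S) (P : S.Rel) : Prop :=
  Sig.Occurs P ∧ ¬ Sig.Intensional P

/-- The edges `P → P'` of the predicate graph. -/
def PredEdge (Sig : DatalogProgram S) (P P' : S.Rel) : Prop :=
  ∃ r ∈ Sig, r.head.rel = P' ∧ ∃ α ∈ r.body, α.rel = P

/-- The program is non-recursive: its predicate graph has no directed cycle. -/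
def NonRecursive (Sig : DatalogProgram S) : Prop :=
  ∀ P, ¬ Relation.TransGen Sig.PredEdge P P

/-- `D` is a database over the extensional schema: a finite set of facts with extensional
predicates. -/
def IsDatabase {C : Type*} (Sig : DatalogProgram S) (D : Set (RelAtom S C)) : Prop :=
  D.Finite ∧ ∀ α ∈ D, Sig.Extensional α.rel

/-- The facts that can be formed from predicates of the program and constants of `D`. -/
def base {C : Type*} (Sig : DatalogProgram S) (D : Set (RelAtom S C)) : Set (RelAtom S C) :=
  {α | Sig.Occurs α.rel ∧ ∀ i, α.args i ∈ activeDomain D}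

end DatalogProgram

/-- A Datalog query `(Σ, R)`, with `R` an intensional predicate of `Σ`. -/
structure DatalogQuery (S : Schema) where
  prog : DatalogProgram S
  goal : S.Rel
  goal_intensional : prog.Intensional goal

/-! ### Proof trees -/

/-- Finite rooted trees with node labels in `A`. The children of a node are listed in some order;
a node is a leaf if it has `0` children. -/
inductive LabeledTree (A : Type*) where
  | node (label : A) (n : ℕ) (child : Fin n → LabeledTree A) : LabeledTree A

namespace LabeledTree

variable {A : Type*}

/-- The label of the root. -/
def rootLabel : LabeledTree A → A
  | node a _ _ => a

/-- The set of the labels of all nodes. -/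
def labels : LabeledTree A → Set A
  | node a _ c => {b | b = a ∨ ∃ i, b ∈ (c i).labels}

/-- The support: the set of the labels of all leaves. -/
def support : LabeledTree A → Set A
  | node a n c => {b | (n = 0 ∧ b = a) ∨ ∃ i, b ∈ (c i).support}

/-- No node has the same label as one of its proper descendants. -/
def NonRecursive : LabeledTree A → Prop
  | node a _ c => (∀ i, a ∉ (c i).labels) ∧ ∀ i, (c i).NonRecursive

end LabeledTree

/-- All conditions on a proof tree w.r.t. the database `D` and the program `Sig`, except that on the
label of the root: labels are from the base, leaves are labeled with facts of `D`, and each inner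
node together with its children is an instance of a rule. -/
def IsProofTree {S : Schema} {C : Type*} (Sig : DatalogProgram S) (D : Set (RelAtom S C)) :
    LabeledTree (RelAtom S C) → Prop
  | .node a n c =>
      a ∈ Sig.base D ∧
      (n = 0 → a ∈ D) ∧
      (n ≠ 0 → ∃ r ∈ Sig, ∃ h : ℕ → C, a = r.head.map h ∧
        ∃ hn : n = r.body.length,
          ∀ i : Fin n, (c i).rootLabel = (r.body.get (i.cast hn)).map h) ∧
      ∀ i, IsProofTree Sig D (c i)

namespace DatalogQuery

variable {S : Schema}

/-- The query is non-recursive. -/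
def NonRecursive (Q : DatalogQuery S) : Prop := Q.prog.NonRecursive

/-- The why-provenance of the tuple `t` w.r.t. `D` and `Q` relative to non-recursive proof trees. -/
def whyNR {C : Type*} (Q : DatalogQuery S) (D : Set (RelAtom S C))
    (t : Fin (S.arity Q.goal) → C) : Set (Set (RelAtom S C)) :=
  {E | ∃ T : LabeledTree (RelAtom S C),
    IsProofTree Q.prog D T ∧ T.rootLabel = ⟨Q.goal, t⟩ ∧ T.NonRecursive ∧ T.support = E}

/-- `(D, t, E)` is an input of the problem: `D` is a database over the extensional schema, `t` is a
tuple over the active domain of `D`, and `E` is a subset of `D`. -/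
def IsInput {C : Type*} (Q : DatalogQuery S) (D : Set (RelAtom S C))
    (t : Fin (S.arity Q.goal) → C) (E : Set (RelAtom S C)) : Prop :=
  Q.prog.IsDatabase D ∧ (∀ i, t i ∈ activeDomain D) ∧ E ⊆ D

end DatalogQuery

/-! ### Boolean circuits with gates of unbounded fan-in -/

/-- The types of gates: gates that read an input bit (named by an element of `I`), negations,
and conjunctions and disjunctions of arbitrary fan-in. -/
inductive GateKind (I : Type*) where
  | input (i : I)
  | not
  | and
  | or

/-- A Boolean circuit with gates `G` and input bits `I`. `wire g h` says that the gate `h` feeds into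
the gate `g`; a negation has exactly one incoming wire. -/
structure Circuit (G I : Type*) where
  kind : G → GateKind I
  wire : G → G → Prop
  output : G
  acyclic : WellFounded (fun h g => wire g h)
  not_unary : ∀ g, kind g = .not → ∃! h, wire g h

namespace Circuit

variable {G I : Type*}

/-- The value of a gate, on the input in which exactly the bits of `x` are set to `1`. -/
def eval (K : Circuit G I) (x : Set I) (g : G) : Prop :=
  match K.kind g with
  | .input i => i ∈ x
  | .not => ∀ h, K.wire g h → ¬ K.eval x h
  | .and => ∀ h, K.wire g h → K.eval x h
  | .or => ∃ h, ∃ _ : K.wire g h, K.eval x h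
termination_by K.acyclic.wrap g
decreasing_by all_goals assumption

/-- The circuit accepts if the output gate has value `1`. -/
def Accepts (K : Circuit G I) (x : Set I) : Prop := K.eval x K.output

/-- The circuit has depth at most `d`: the gates can be put on the levels `0, …, d` such that each
wire leads to a strictly higher level (that is, no directed path has more than `d` wires). -/
def DepthLE (K : Circuit G I) (d : ℕ) : Prop :=
  ∃ level : G → ℕ, (∀ g h, K.wire g h → level h < level g) ∧ ∀ g, level g ≤ d

end Circuit

/-! ### First-order uniformity -/

/-- Numerical predicates: the order, and the predicate `BIT`. -/
inductive NumericRel : ℕ → Type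
  | le : NumericRel 2
  | bit : NumericRel 2

/-- The first-order vocabulary `{≤, BIT}`. -/
def numericLanguage : FirstOrder.Language := ⟨fun _ => Empty, NumericRel⟩

/-- The standard interpretation over `{0, …, N - 1}`; `BIT(a, b)` says that the bit number `b` in the
binary representation of `a` is `1`. -/
instance numericStructure (N : ℕ) : numericLanguage.Structure (Fin N) where
  funMap := fun f _ => nomatch f
  RelMap := fun {_} r =>
    match r with
    | .le => fun v => v 0 ≤ v 1
    | .bit => fun v => (v 0).val.testBit (v 1).val = true

/-- A family of relations on the sets `{0, …, N - 1}` is first-order definable if one formula over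
`{≤, BIT}` defines them all. -/
def FODefinable {α : Type} (R : ∀ N : ℕ, (α → Fin N) → Prop) : Prop :=
  ∃ φ : numericLanguage.Formula α, ∀ (N : ℕ) (v : α → Fin N), φ.Realize v ↔ R N v

/-- Names of gates: a sort `s` (out of finitely many) together with a tuple over `{0, …, N - 1}`
whose length is the arity of `s`. -/
abbrev GateName {m : ℕ} (a : Fin m → ℕ) (N : ℕ) : Type :=
  (s : Fin m) × (Fin (a s) → Fin N)

/-- A family of circuits, the `N`-th one for inputs that are relational structures with domain
`{0, …, N - 1}`, given by one input bit for each possible atom. -/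
abbrev CircuitFamily (V : Schema) {m : ℕ} (a : Fin m → ℕ) :=
  ∀ N : ℕ, Circuit (GateName a N) (RelAtom V (Fin N))

/-- First-order uniformity: the map that takes `N` to the `N`-th circuit is a first-order
interpretation, i.e. the kinds of the gates, the input bits read by the input gates, the wires and
the output gate are first-order definable. -/
structure CircuitFamily.FOUniform {V : Schema} {m : ℕ} {a : Fin m → ℕ}
    (K : CircuitFamily V a) : Prop where
  not : ∀ s, FODefinable fun N (v : Fin (a s) → Fin N) => (K N).kind ⟨s, v⟩ = .not
  and : ∀ s, FODefinable fun N (v : Fin (a s) → Fin N) => (K N).kind ⟨s, v⟩ = .and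
  or : ∀ s, FODefinable fun N (v : Fin (a s) → Fin N) => (K N).kind ⟨s, v⟩ = .or
  input : ∀ s (P : V.Rel), FODefinable fun N (v : Fin (a s) ⊕ Fin (V.arity P) → Fin N) =>
    (K N).kind ⟨s, fun i => v (.inl i)⟩ = .input ⟨P, fun j => v (.inr j)⟩
  wire : ∀ s s', FODefinable fun N (v : Fin (a s) ⊕ Fin (a s') → Fin N) =>
    (K N).wire ⟨s, fun i => v (.inl i)⟩ ⟨s', fun j => v (.inr j)⟩
  output : ∀ s, FODefinable fun N (v : Fin (a s) → Fin N) => (K N).output = ⟨s, v⟩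

/-! ### The class AC0 -/

/-- A decision problem on relational structures over `V` with a domain of the form
`{0, …, N - 1}`; a structure is identified with its set of true atoms, that is, with the bit vector
that has one bit for each possible atom. (Bit strings are the case of one unary relation.) -/
abbrev StructureProblem (V : Schema) := ∀ N : ℕ, Set (Set (RelAtom V (Fin N)))

/-- The (uniform) class AC0: the problem is decided by a first-order uniform family of circuits with
gates of unbounded fan-in, of constant depth and polynomial size. -/
def InAC0 {V : Schema} (L : StructureProblem V) : Prop :=
  ∃ (m : ℕ) (a : Fin m → ℕ) (K : CircuitFamily V a) (d : ℕ) (p : Polynomial ℕ),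
    K.FOUniform ∧
    (∀ N, (K N).DepthLE d) ∧
    (∀ N, Nat.card (GateName a N) ≤ p.eval N) ∧
    ∀ N (x : Set (RelAtom V (Fin N))), (K N).Accepts x ↔ x ∈ L N

/-! ### The encoding of the inputs `(D, t, E)` and the data complexity of the problem -/

namespace DatalogQuery

variable {S : Schema}

/-- The relation names used to encode an input `(D, t, E)`: for each extensional predicate one copy
for `D` and one copy for `E`, and for each position of `t` a unary relation. -/
def inputSchema (Q : DatalogQuery S) : Schema where
  Rel := {P : S.Rel // Q.prog.Extensional P} ⊕
    ({P : S.Rel // Q.prog.Extensional P} ⊕ Fin (S.arity Q.goal))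
  arity := Sum.elim (fun P => S.arity P.1) (Sum.elim (fun P => S.arity P.1) (fun _ => 1))
  finite := by
    have := S.finite
    infer_instance

/-- The encoding of `(D, t, E)`, when the constants are numbered by `ν`: a bit for each possible fact
that says whether it is in `D`, a bit for each possible fact that says whether it is in `E`, and a bit
for each position `i` and each constant that says whether this constant is `t i`. -/
def encode {C : Type*} (Q : DatalogQuery S) {N : ℕ} (ν : Fin N → C) (D : Set (RelAtom S C))
    (t : Fin (S.arity Q.goal) → C) (E : Set (RelAtom S C)) :
    Set (RelAtom Q.inputSchema (Fin N)) :=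
  {b | match b with
    | ⟨.inl P, u⟩ => (⟨P.1, fun j => ν (u j)⟩ : RelAtom S C) ∈ D
    | ⟨.inr (.inl P), u⟩ => (⟨P.1, fun j => ν (u j)⟩ : RelAtom S C) ∈ E
    | ⟨.inr (.inr i), u⟩ => ν (u (0 : Fin 1)) = t i}

/-- `ν` numbers the constants of `D` bijectively by `0, …, N - 1`. -/
def IsNumbering {C : Type*} {N : ℕ} (ν : Fin N → C) (D : Set (RelAtom S C)) : Prop :=
  Function.Injective ν ∧ Set.range ν = activeDomain D

/-- The problem `Why-Provenance_NR[Q]`, for the fixed query `Q`, is in AC0: some problem `L` in AC0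
consists of encodings of inputs only, and contains an encoding of an input `(D, t, E)` if and only if
`E` is in the why-provenance of `t` relative to non-recursive proof trees. -/
def WhyProvenanceNRInAC0 (C : Type*) (Q : DatalogQuery S) : Prop :=
  ∃ L : StructureProblem Q.inputSchema, InAC0 L ∧
    (∀ N, ∀ x ∈ L N, ∃ (ν : Fin N → C) (D : Set (RelAtom S C)) (t : Fin (S.arity Q.goal) → C)
      (E : Set (RelAtom S C)), Q.IsInput D t E ∧ IsNumbering ν D ∧ x = Q.encode ν D t E) ∧
    ∀ (D : Set (RelAtom S C)) (t : Fin (S.arity Q.goal) → C) (E : Set (RelAtom S C)),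
      Q.IsInput D t E → ∀ (N : ℕ) (ν : Fin N → C), IsNumbering ν D →
        (Q.encode ν D t E ∈ L N ↔ E ∈ Q.whyNR D t)

end DatalogQuery

/-!
# Why-provenance of non-recursive Datalog queries is in AC0

In a non-recursive program the predicates along a path of a proof tree strictly descend in the
predicate graph. So every proof tree is non-recursive (`IsProofTree.nonRecursive`), and as depth and
branching are bounded, its support contains at most `M` constants, where `M` depends only on the query
(`DatalogProgram.NonRecursive.exists_encard_activeDomain_support_le`). By safety of the rules, a proof
tree uses only facts and constants of its support (`IsProofTree.of_support_subset`), and it can be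
mapped along any map of constants (`IsProofTree.map`). Hence `E` explains `t` if and only if `(E, t)`
is the image, under some map `h`, of one of the finitely many pairs `(E₀, t₀)` over `{0, …, n - 1}`
with `n ≤ M` in which `E₀` explains `t₀`
(`DatalogQuery.exists_mem_whyNR_iff_isPattern`). No unfolding of the program into conjunctive queries
is needed: the finite list of pairs depends on the query alone.

That some `h` matches a given pair `(E₀, t₀)` with the input is a first-order property of the encoded
input (`DatalogQuery.foQuery_hasMatch`), and so is the validity of the encoding
(`DatalogQuery.foQuery_isEncoding`). Finally, every first-order sentence is evaluated by a uniform
family of circuits of constant depth, whose gates are named by a subformula and an assignment of its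
free variables (`FOFormula.inAC0`); a quantifier becomes a gate of unbounded fan-in.
-/

/-! ### First-order definability over `{≤, BIT}` -/

namespace FODefinable

variable {α : Type}

theorem congr {R R' : ∀ N : ℕ, (α → Fin N) → Prop} (h : FODefinable R)
    (hR : ∀ N v, R N v ↔ R' N v) : FODefinable R' := by
  obtain ⟨φ, hφ⟩ := h
  exact ⟨φ, fun N v => (hφ N v).trans (hR N v)⟩

theorem const (p : Prop) : FODefinable fun N (_ : α → Fin N) => p := by
  by_cases hp : p
  · exact ⟨⊤, fun N v => by simp [hp]⟩
  · exact ⟨⊥, fun N v => by simp [hp]⟩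

theorem eq (i j : α) : FODefinable fun N (v : α → Fin N) => v i = v j :=
  ⟨(FirstOrder.Language.Term.var i).equal (.var j), fun N v => by
    simp [FirstOrder.Language.Formula.realize_equal]⟩

theorem or {R R' : ∀ N : ℕ, (α → Fin N) → Prop} (h : FODefinable R) (h' : FODefinable R') :
    FODefinable fun N v => R N v ∨ R' N v := by
  obtain ⟨φ, hφ⟩ := h
  obtain ⟨ψ, hψ⟩ := h'
  exact ⟨φ ⊔ ψ, fun N v => by simp [hφ, hψ]⟩

theorem not {R : ∀ N : ℕ, (α → Fin N) → Prop} (h : FODefinable R) :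
    FODefinable fun N v => ¬ R N v := by
  obtain ⟨φ, hφ⟩ := h
  exact ⟨φ.not, fun N v => by simp [hφ]⟩

theorem forall_finite {ι : Type} [Finite ι] {R : ι → ∀ N : ℕ, (α → Fin N) → Prop}
    (h : ∀ i, FODefinable (R i)) : FODefinable fun N v => ∀ i, R i N v := by
  choose φ hφ using h
  exact ⟨.iInf φ, fun N v => by simp [hφ]⟩

end FODefinable

/-! ### First-order formulas over an input structure -/

/-- First-order formulas, with free variables `0, …, k - 1`, over the relations of `V` and
equality. Variables are de Bruijn levels, and quantifiers bind blocks of variables. -/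
inductive FOFormula (V : Schema) : ℕ → Type
  | verum {k : ℕ} : FOFormula V k
  | eq {k : ℕ} (i j : Fin k) : FOFormula V k
  | atom {k : ℕ} (P : V.Rel) (f : Fin (V.arity P) → Fin k) : FOFormula V k
  | neg {k : ℕ} (φ : FOFormula V k) : FOFormula V k
  | and {k : ℕ} (φ ψ : FOFormula V k) : FOFormula V k
  | exs {k : ℕ} (n : ℕ) (φ : FOFormula V (k + n)) : FOFormula V k

namespace FOFormula

variable {V : Schema}

/-- Truth of a formula in the structure over `{0, …, N - 1}` whose true atoms are those of `x`. -/
def Realize {N : ℕ} (x : Set (RelAtom V (Fin N))) : {k : ℕ} →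
    FOFormula V k → (Fin k → Fin N) → Prop
  | _, verum, _ => True
  | _, eq i j, v => v i = v j
  | _, atom P f, v => ⟨P, fun i => v (f i)⟩ ∈ x
  | _, neg φ, v => ¬ φ.Realize x v
  | _, and φ ψ, v => φ.Realize x v ∧ ψ.Realize x v
  | _, exs n φ, v => ∃ w : Fin n → Fin N, φ.Realize x (Fin.append v w)

/-- The height of the syntax tree of a formula. -/
def height : {k : ℕ} → FOFormula V k → ℕ
  | _, verum => 0
  | _, eq _ _ => 0
  | _, atom _ _ => 0
  | _, neg φ => φ.height + 1
  | _, and φ ψ => max φ.height ψ.height + 1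
  | _, exs _ φ => φ.height + 1

/-- The subformulas of a formula, each with its number of free variables. -/
def subformulas : {k : ℕ} → FOFormula V k → Set (Σ k, FOFormula V k)
  | k, verum => {⟨k, verum⟩}
  | k, eq i j => {⟨k, eq i j⟩}
  | k, atom P f => {⟨k, atom P f⟩}
  | k, neg φ => insert ⟨k, neg φ⟩ φ.subformulas
  | k, and φ ψ => insert ⟨k, and φ ψ⟩ (φ.subformulas ∪ ψ.subformulas)
  | k, exs n φ => insert ⟨k, exs n φ⟩ φ.subformulas

theorem self_mem_subformulas {k : ℕ} (φ : FOFormula V k) : ⟨k, φ⟩ ∈ φ.subformulas := by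
  cases φ <;> simp [subformulas]

theorem finite_subformulas {k : ℕ} (φ : FOFormula V k) : φ.subformulas.Finite := by
  induction φ with
  | verum | eq | atom => exact Set.finite_singleton _
  | neg φ ih | exs n φ ih => exact ih.insert _
  | and φ ψ ih ih' => exact (ih.union ih').insert _

theorem subformulas_subset {k : ℕ} (φ : FOFormula V k) :
    ∀ p ∈ φ.subformulas, p.2.subformulas ⊆ φ.subformulas := by
  induction φ with
  | verum | eq | atom => rintro p rfl; exact subset_rfl
  | neg φ ih | exs n φ ih =>
    rintro p (rfl | hp)
    · exact subset_rfl
    · exact (ih p hp).trans (Set.subset_insert _ _)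
  | and φ ψ ih ih' =>
    rintro p (rfl | hp | hp)
    · exact subset_rfl
    · exact (ih p hp).trans (Set.subset_union_left.trans (Set.subset_insert _ _))
    · exact (ih' p hp).trans (Set.subset_union_right.trans (Set.subset_insert _ _))

/-! ### The circuit of all formulas -/

/-- The gates of `evalCircuit`: a formula with an assignment of its free variables. -/
abbrev Gate (V : Schema) (N : ℕ) : Type := (p : Σ k, FOFormula V k) × (Fin p.1 → Fin N)

/-- The kind of the gate that evaluates a formula. An equality is evaluated by a gate without
incoming wires: the empty conjunction `and` is true, the empty disjunction `or` is false. -/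
def gateKind {N : ℕ} : Gate V N → GateKind (RelAtom V (Fin N))
  | ⟨⟨_, verum⟩, _⟩ => .and
  | ⟨⟨_, eq i j⟩, v⟩ => if v i = v j then .and else .or
  | ⟨⟨_, atom P f⟩, v⟩ => .input ⟨P, fun i => v (f i)⟩
  | ⟨⟨_, neg _⟩, _⟩ => .not
  | ⟨⟨_, and _ _⟩, _⟩ => .and
  | ⟨⟨_, exs _ _⟩, _⟩ => .or

/-- The wires of `evalCircuit` lead from the immediate subformulas to a formula. -/
def gateWire {N : ℕ} : Gate V N → Gate V N → Prop
  | ⟨⟨_, verum⟩, _⟩, _ => False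
  | ⟨⟨_, eq _ _⟩, _⟩, _ => False
  | ⟨⟨_, atom _ _⟩, _⟩, _ => False
  | ⟨⟨_, neg φ⟩, v⟩, h => h = ⟨⟨_, φ⟩, v⟩
  | ⟨⟨_, and φ ψ⟩, v⟩, h => h = ⟨⟨_, φ⟩, v⟩ ∨ h = ⟨⟨_, ψ⟩, v⟩
  | ⟨⟨_, exs n φ⟩, v⟩, h => ∃ w : Fin n → Fin N, h = ⟨⟨_, φ⟩, Fin.append v w⟩

theorem height_lt_of_gateWire {N : ℕ} {g h : Gate V N} (hw : gateWire g h) :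
    h.1.2.height < g.1.2.height := by
  obtain ⟨⟨k, φ⟩, v⟩ := g
  cases φ with
  | verum | eq | atom => exact hw.elim
  | neg φ => obtain rfl := hw; simp [height]
  | and φ ψ => obtain rfl | rfl := hw <;> simp [height]
  | exs n φ => obtain ⟨w, rfl⟩ := hw; simp [height]

theorem mem_subformulas_of_gateWire {N : ℕ} {g h : Gate V N} (hw : gateWire g h) :
    h.1 ∈ g.1.2.subformulas := by
  obtain ⟨⟨k, φ⟩, v⟩ := g
  cases φ with
  | verum | eq | atom => exact hw.elim
  | neg φ => obtain rfl := hw; exact .inr φ.self_mem_subformulas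
  | and φ ψ =>
    obtain rfl | rfl := hw
    · exact .inr (.inl φ.self_mem_subformulas)
    · exact .inr (.inr ψ.self_mem_subformulas)
  | exs n φ => obtain ⟨w, rfl⟩ := hw; exact .inr φ.self_mem_subformulas

theorem existsUnique_gateWire {N : ℕ} (g : Gate V N) (hg : gateKind g = .not) :
    ∃! h, gateWire g h := by
  obtain ⟨⟨k, φ⟩, v⟩ := g
  cases φ with
  | neg φ => exact ⟨_, rfl, fun h hh => hh⟩
  | eq i j => simp only [gateKind] at hg; split_ifs at hg
  | verum | atom | and | exs => simp [gateKind] at hg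

/-- The circuit with one gate for every formula and every assignment of its free variables, with
output the sentence `φ`. It has infinitely many gates; `restrict` cuts out those that `φ` uses. -/
def evalCircuit (N : ℕ) (φ : FOFormula V 0) : Circuit (Gate V N) (RelAtom V (Fin N)) where
  kind := gateKind
  wire := gateWire
  output := ⟨⟨0, φ⟩, Fin.elim0⟩
  acyclic := Subrelation.wf (fun h => height_lt_of_gateWire h)
    (InvImage.wf (fun g : Gate V N => g.1.2.height) wellFounded_lt)
  not_unary := existsUnique_gateWire

theorem eval_evalCircuit {N : ℕ} (φ₀ : FOFormula V 0) (x : Set (RelAtom V (Fin N))) {k : ℕ}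
    (φ : FOFormula V k) (v : Fin k → Fin N) :
    (evalCircuit N φ₀).eval x ⟨⟨k, φ⟩, v⟩ ↔ φ.Realize x v := by
  induction φ with
  | verum => rw [Circuit.eval]; simp [evalCircuit, gateKind, gateWire, Realize]
  | eq i j =>
    rw [Circuit.eval]
    by_cases h : v i = v j <;> simp [evalCircuit, gateKind, gateWire, Realize, h]
  | atom P f => rw [Circuit.eval]; simp [evalCircuit, gateKind, Realize]
  | neg φ ih =>
    rw [Circuit.eval]
    simp only [Realize, ← ih]
    simp [evalCircuit, gateKind, gateWire]
  | and φ ψ ih ih' =>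
    rw [Circuit.eval]
    simp only [Realize, ← ih, ← ih']
    simp [evalCircuit, gateKind, gateWire]
  | exs n φ ih =>
    rw [Circuit.eval]
    simp only [Realize, ← ih]
    constructor
    · rintro ⟨_, ⟨w, rfl⟩, h⟩
      exact ⟨w, h⟩
    · rintro ⟨w, h⟩
      exact ⟨_, ⟨w, rfl⟩, h⟩

end FOFormula

namespace Circuit

variable {G H I : Type*}

/-- The restriction of a circuit along an injection of gates, if all gates that feed into a gate of
the range are in the range. -/
def restrict (K : Circuit G I) (f : H → G) (hf : Function.Injective f) (o : H)
    (hcl : ∀ h g, K.wire (f h) g → g ∈ Set.range f) : Circuit H I where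
  kind h := K.kind (f h)
  wire h h' := K.wire (f h) (f h')
  output := o
  acyclic := InvImage.wf f K.acyclic
  not_unary h hh := by
    obtain ⟨g, hg, hu⟩ := K.not_unary _ hh
    obtain ⟨h', rfl⟩ := hcl h g hg
    exact ⟨h', hg, fun h'' hw => hf (hu _ hw)⟩

theorem eval_restrict (K : Circuit G I) (f : H → G) (hf : Function.Injective f) (o : H)
    (hcl : ∀ h g, K.wire (f h) g → g ∈ Set.range f) (x : Set I) (h : H) :
    (K.restrict f hf o hcl).eval x h ↔ K.eval x (f h) := by
  induction h using (K.restrict f hf o hcl).acyclic.induction with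
  | _ h ih =>
    have ih' : ∀ h', K.wire (f h) (f h') →
        ((K.restrict f hf o hcl).eval x h' ↔ K.eval x (f h')) := ih
    have hall : ∀ p : G → Prop, (∀ g, K.wire (f h) g → p g) ↔
        ∀ h', K.wire (f h) (f h') → p (f h') := fun p =>
      ⟨fun hp h' => hp (f h'), fun hp g hg => by
        obtain ⟨h', rfl⟩ := hcl h g hg
        exact hp h' hg⟩
    rw [eval, eval]
    change (match K.kind (f h) with
      | .input i => i ∈ x
      | .not => ∀ h', K.wire (f h) (f h') → ¬ (K.restrict f hf o hcl).eval x h'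
      | .and => ∀ h', K.wire (f h) (f h') → (K.restrict f hf o hcl).eval x h'
      | .or => ∃ h', ∃ _ : K.wire (f h) (f h'), (K.restrict f hf o hcl).eval x h') ↔ _
    cases K.kind (f h) with
    | input i => exact Iff.rfl
    | not =>
      refine Iff.trans ?_ (hall _).symm
      exact forall₂_congr fun h' hw => not_congr (ih' h' hw)
    | and =>
      refine Iff.trans ?_ (hall _).symm
      exact forall₂_congr fun h' hw => ih' h' hw
    | or =>
      constructor
      · rintro ⟨h', hw, he⟩
        exact ⟨_, hw, (ih' h' hw).1 he⟩
      · rintro ⟨g, hw, he⟩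
        obtain ⟨h', rfl⟩ := hcl h g hw
        exact ⟨h', hw, (ih' h' hw).2 he⟩

end Circuit

namespace FOFormula

variable {V : Schema}

/-! ### Uniformity of the circuit of all formulas -/

theorem foDefinable_gate_eq {α : Type} (p q : Σ k, FOFormula V k) (e : Fin p.1 → α)
    (f : Fin q.1 → α) :
    FODefinable fun N (v : α → Fin N) =>
      (⟨p, fun i => v (e i)⟩ : Gate V N) = ⟨q, fun i => v (f i)⟩ := by
  by_cases h : p = q
  · subst h
    refine (FODefinable.forall_finite fun i => FODefinable.eq (e i) (f i)).congr fun N v => ?_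
    rw [Sigma.mk.injEq, heq_eq_eq, funext_iff]
    simp
  · exact (FODefinable.const False).congr fun N v => by simp [Sigma.mk.injEq, h]

theorem foDefinable_gateWire (p q : Σ k, FOFormula V k) :
    FODefinable fun N (v : Fin p.1 ⊕ Fin q.1 → Fin N) =>
      gateWire ⟨p, fun i => v (.inl i)⟩ ⟨q, fun j => v (.inr j)⟩ := by
  obtain ⟨k, φ⟩ := p
  cases φ with
  | verum | eq | atom => exact FODefinable.const False
  | neg φ => exact foDefinable_gate_eq q ⟨k, φ⟩ Sum.inr Sum.inl
  | and φ ψ =>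
    exact (foDefinable_gate_eq q ⟨k, φ⟩ Sum.inr Sum.inl).or
      (foDefinable_gate_eq q ⟨k, ψ⟩ Sum.inr Sum.inl)
  | exs n φ =>
    by_cases h : q = ⟨k + n, φ⟩
    · subst h
      -- The quantified block is read off the lower gate, so only the free variables are compared.
      refine (FODefinable.forall_finite fun i : Fin k =>
        FODefinable.eq (.inr (Fin.castAdd n i)) (.inl i)).congr fun N v => ?_
      simp only [gateWire, Sigma.mk.injEq, heq_eq_eq, true_and]
      constructor
      · intro hv
        refine ⟨fun i => v (.inr (Fin.natAdd k i)), funext fun i => ?_⟩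
        induction i using Fin.addCases with
        | left i => simp [hv]
        | right i => simp
      · rintro ⟨w, hw⟩ i
        simpa using congrFun hw (Fin.castAdd n i)
    · exact (FODefinable.const False).congr fun N v => by simp [gateWire, Sigma.mk.injEq, h]

theorem foDefinable_gateKind_not (p : Σ k, FOFormula V k) :
    FODefinable fun N (v : Fin p.1 → Fin N) => gateKind ⟨p, v⟩ = .not := by
  obtain ⟨k, φ⟩ := p
  cases φ with
  | eq i j =>
    exact (FODefinable.const False).congr fun N v => by
      by_cases h : v i = v j <;> simp [gateKind, h]
  | verum | atom | neg | and | exs =>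
    simp only [gateKind, reduceCtorEq]
    exact FODefinable.const _

theorem foDefinable_gateKind_and (p : Σ k, FOFormula V k) :
    FODefinable fun N (v : Fin p.1 → Fin N) => gateKind ⟨p, v⟩ = .and := by
  obtain ⟨k, φ⟩ := p
  cases φ with
  | eq i j =>
    exact (FODefinable.eq i j).congr fun N v => by
      by_cases h : v i = v j <;> simp [gateKind, h]
  | verum | atom | neg | and | exs =>
    simp only [gateKind, reduceCtorEq]
    exact FODefinable.const _

theorem foDefinable_gateKind_or (p : Σ k, FOFormula V k) :
    FODefinable fun N (v : Fin p.1 → Fin N) => gateKind ⟨p, v⟩ = .or := by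
  obtain ⟨k, φ⟩ := p
  cases φ with
  | eq i j =>
    exact (FODefinable.eq i j).not.congr fun N v => by
      by_cases h : v i = v j <;> simp [gateKind, h]
  | verum | atom | neg | and | exs =>
    simp only [gateKind, reduceCtorEq]
    exact FODefinable.const _

theorem foDefinable_gateKind_input (p : Σ k, FOFormula V k) (P : V.Rel) :
    FODefinable fun N (v : Fin p.1 ⊕ Fin (V.arity P) → Fin N) =>
      gateKind ⟨p, fun i => v (.inl i)⟩ = .input ⟨P, fun j => v (.inr j)⟩ := by
  obtain ⟨k, φ⟩ := p
  cases φ with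
  | eq i j =>
    exact (FODefinable.const False).congr fun N v => by
      by_cases h : v (.inl i) = v (.inl j) <;> simp [gateKind, h]
  | atom P' f =>
    by_cases h : P' = P
    · subst h
      refine (FODefinable.forall_finite fun i =>
        FODefinable.eq (.inl (f i)) (.inr i)).congr fun N v => ?_
      simp [gateKind, funext_iff]
    · exact (FODefinable.const False).congr fun N v => by simp [gateKind, h]
  | verum | neg | and | exs =>
    simp only [gateKind, reduceCtorEq]
    exact FODefinable.const _

/-- A problem defined by a first-order sentence is in AC0: the gates are the pairs of a subformula
and an assignment of its free variables. -/
theorem inAC0 (φ : FOFormula V 0) {L : StructureProblem V}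
    (hL : ∀ N (x : Set (RelAtom V (Fin N))), φ.Realize x Fin.elim0 ↔ x ∈ L N) : InAC0 L := by
  have := φ.finite_subformulas.to_subtype
  let e := (Finite.equivFin φ.subformulas).symm
  let a : Fin (Nat.card φ.subformulas) → ℕ := fun s => (e s).1.1
  let emb (N : ℕ) : GateName a N → Gate V N := fun g => ⟨(e g.1).1, g.2⟩
  have emb_inj (N : ℕ) : Function.Injective (emb N) := by
    rintro ⟨s, v⟩ ⟨s', v'⟩ h
    have hs : s = s' := e.injective (Subtype.ext (congrArg Sigma.fst h))
    subst hs
    obtain rfl : v = v' := by simpa [emb] using h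
    rfl
  have mem_range (N : ℕ) (g : Gate V N) (hg : g.1 ∈ φ.subformulas) : g ∈ Set.range (emb N) := by
    obtain ⟨p, v⟩ := g
    obtain ⟨s, hs⟩ := e.surjective ⟨p, hg⟩
    obtain rfl : (e s).1 = p := congrArg Subtype.val hs
    exact ⟨⟨s, v⟩, rfl⟩
  have hcl (N : ℕ) (h : GateName a N) (g : Gate V N)
      (hw : (evalCircuit N φ).wire (emb N h) g) : g ∈ Set.range (emb N) :=
    mem_range N g (φ.subformulas_subset _ (e h.1).2 (mem_subformulas_of_gateWire hw))
  choose o ho using fun N => mem_range N (evalCircuit N φ).output φ.self_mem_subformulas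
  let K : CircuitFamily V a := fun N => (evalCircuit N φ).restrict (emb N) (emb_inj N) (o N) (hcl N)
  refine ⟨_, a, K, ∑ s, (e s).1.2.height, ∑ s, Polynomial.X ^ a s, ?_, ?_, ?_, ?_⟩
  · refine ⟨fun s => foDefinable_gateKind_not _, fun s => foDefinable_gateKind_and _,
      fun s => foDefinable_gateKind_or _, fun s P => foDefinable_gateKind_input _ P,
      fun s s' => foDefinable_gateWire _ _, fun s => ?_⟩
    refine (foDefinable_gate_eq ⟨0, φ⟩ (e s).1 Fin.elim0 id).congr fun N v => ?_
    rw [← (emb_inj N).eq_iff]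
    change _ ↔ emb N (o N) = _
    rw [ho]
    have : (fun i : Fin 0 => v i.elim0) = Fin.elim0 := Subsingleton.elim _ _
    simp only [this]
    rfl
  · intro N
    refine ⟨fun g => (e g.1).1.2.height, fun g h hw => height_lt_of_gateWire hw, fun g => ?_⟩
    exact Finset.single_le_sum (f := fun s => (e s).1.2.height) (fun _ _ => Nat.zero_le _)
      (Finset.mem_univ g.1)
  · intro N
    rw [Nat.card_sigma]
    simp [Polynomial.eval_finsetSum]
  · intro N x
    rw [← hL N x, Circuit.Accepts, Circuit.eval_restrict]
    change (evalCircuit N φ).eval x (emb N (o N)) ↔ _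
    rw [ho]
    exact eval_evalCircuit φ x φ Fin.elim0

end FOFormula

/-! ### Closure properties of first-order definable queries -/

/-- A query `R N x v`, about a structure `x` over `{0, …, N - 1}` and a `k`-tuple `v` of its elements,
is first-order if one formula defines it for all `N`. -/
def FOQuery (V : Schema) (k : ℕ)
    (R : ∀ N : ℕ, Set (RelAtom V (Fin N)) → (Fin k → Fin N) → Prop) : Prop :=
  ∃ φ : FOFormula V k, ∀ N x v, φ.Realize x v ↔ R N x v

namespace FOQuery

variable {V : Schema} {k : ℕ} {R R' : ∀ N : ℕ, Set (RelAtom V (Fin N)) → (Fin k → Fin N) → Prop}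

theorem congr (h : FOQuery V k R) (hR : ∀ N x v, R N x v ↔ R' N x v) : FOQuery V k R' := by
  obtain ⟨φ, hφ⟩ := h
  exact ⟨φ, fun N x v => (hφ N x v).trans (hR N x v)⟩

theorem eq (i j : Fin k) : FOQuery V k fun _ _ v => v i = v j :=
  ⟨.eq i j, fun _ _ _ => Iff.rfl⟩

theorem atom (P : V.Rel) (f : Fin (V.arity P) → Fin k) :
    FOQuery V k fun _ x v => ⟨P, fun i => v (f i)⟩ ∈ x :=
  ⟨.atom P f, fun _ _ _ => Iff.rfl⟩

theorem not (h : FOQuery V k R) : FOQuery V k fun N x v => ¬ R N x v := by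
  obtain ⟨φ, hφ⟩ := h
  exact ⟨.neg φ, fun N x v => not_congr (hφ N x v)⟩

theorem and (h : FOQuery V k R) (h' : FOQuery V k R') :
    FOQuery V k fun N x v => R N x v ∧ R' N x v := by
  obtain ⟨φ, hφ⟩ := h
  obtain ⟨ψ, hψ⟩ := h'
  exact ⟨.and φ ψ, fun N x v => and_congr (hφ N x v) (hψ N x v)⟩

theorem imp (h : FOQuery V k R) (h' : FOQuery V k R') :
    FOQuery V k fun N x v => R N x v → R' N x v :=
  (h.and h'.not).not.congr fun N x v => by tauto

theorem iff (h : FOQuery V k R) (h' : FOQuery V k R') :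
    FOQuery V k fun N x v => (R N x v ↔ R' N x v) :=
  ((h.imp h').and (h'.imp h)).congr fun N x v => by tauto

theorem const (p : Prop) : FOQuery V k fun _ _ _ => p := by
  by_cases hp : p
  · exact ⟨.verum, fun N x v => by simp [FOFormula.Realize, hp]⟩
  · exact ⟨.neg .verum, fun N x v => by simp [FOFormula.Realize, hp]⟩

theorem forall_finite {ι : Type*} [Finite ι]
    {R : ι → ∀ N : ℕ, Set (RelAtom V (Fin N)) → (Fin k → Fin N) → Prop}
    (h : ∀ i, FOQuery V k (R i)) : FOQuery V k fun N x v => ∀ i, R i N x v := by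
  have key : ∀ s : Set ι, s.Finite → FOQuery V k fun N x v => ∀ i ∈ s, R i N x v := by
    intro s hs
    induction s, hs using Set.Finite.induction_on with
    | empty => exact (const True).congr fun N x v => by simp
    | @insert i _ _ _ ih => exact ((h i).and ih).congr fun N x v => by simp
  exact (key _ Set.finite_univ).congr fun N x v => by simp

theorem exists_finite {ι : Type*} [Finite ι]
    {R : ι → ∀ N : ℕ, Set (RelAtom V (Fin N)) → (Fin k → Fin N) → Prop}
    (h : ∀ i, FOQuery V k (R i)) : FOQuery V k fun N x v => ∃ i, R i N x v :=
  (forall_finite fun i => (h i).not).not.congr fun N x v => by simp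

theorem exists_tuple (n : ℕ)
    {R : ∀ N : ℕ, Set (RelAtom V (Fin N)) → (Fin k → Fin N) → (Fin n → Fin N) → Prop}
    (h : FOQuery V (k + n) fun N x v =>
      R N x (fun i => v (Fin.castAdd n i)) (fun j => v (Fin.natAdd k j))) :
    FOQuery V k fun N x v => ∃ w, R N x v w := by
  obtain ⟨φ, hφ⟩ := h
  exact ⟨.exs n φ, fun N x v => exists_congr fun w => by simp [hφ]⟩

theorem forall_tuple (n : ℕ)
    {R : ∀ N : ℕ, Set (RelAtom V (Fin N)) → (Fin k → Fin N) → (Fin n → Fin N) → Prop}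
    (h : FOQuery V (k + n) fun N x v =>
      R N x (fun i => v (Fin.castAdd n i)) (fun j => v (Fin.natAdd k j))) :
    FOQuery V k fun N x v => ∀ w, R N x v w :=
  (exists_tuple n (R := fun N x v w => ¬ R N x v w) h.not).not.congr fun N x v => by simp

theorem atom_eq {S : Schema} (α : RelAtom S (Fin k)) (P : S.Rel) (f : Fin (S.arity P) → Fin k) :
    FOQuery V k fun _ _ v => α.map v = ⟨P, fun i => v (f i)⟩ := by
  obtain ⟨P', g⟩ := α
  by_cases h : P' = P
  · subst h
    exact (forall_finite fun i => eq (g i) (f i)).congr fun N x v => by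
      simp [RelAtom.map, funext_iff]
  · exact (const False).congr fun N x v => by simp [RelAtom.map, h]

end FOQuery

/-! ### Proof trees -/

section Schema

variable {S : Schema}

theorem RelAtom.map_map {T U W : Type*} (g : U → W) (h : T → U) (α : RelAtom S T) :
    (α.map h).map g = α.map (g ∘ h) := rfl

theorem RelAtom.finite (T : Type*) [Finite T] : Finite (RelAtom S T) := by
  have := S.finite
  refine Finite.of_injective
    (fun α : RelAtom S T => (⟨α.rel, α.args⟩ : (P : S.Rel) × (Fin (S.arity P) → T))) ?_
  rintro ⟨P, u⟩ ⟨P', u'⟩ h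
  simpa using h

theorem activeDomain_mono {T : Type*} {D D' : Set (RelAtom S T)} (h : D ⊆ D') :
    activeDomain D ⊆ activeDomain D' :=
  fun _ ⟨α, hα, i, hi⟩ => ⟨α, h hα, i, hi⟩

end Schema

namespace LabeledTree

variable {A B : Type*}

/-- Apply a map to all labels of a tree. -/
def map (g : A → B) : LabeledTree A → LabeledTree B
  | node a n c => node (g a) n fun i => (c i).map g

theorem rootLabel_map (g : A → B) (T : LabeledTree A) :
    (T.map g).rootLabel = g T.rootLabel := by
  cases T; rfl

theorem support_map (g : A → B) (T : LabeledTree A) : (T.map g).support = g '' T.support := by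
  induction T with
  | node a n c ih =>
    ext b
    simp only [map, support, ih, Set.mem_image, Set.mem_ofPred_eq]
    constructor
    · rintro (⟨hn, rfl⟩ | ⟨i, b', hb', rfl⟩)
      · exact ⟨a, .inl ⟨hn, rfl⟩, rfl⟩
      · exact ⟨b', .inr ⟨i, hb'⟩, rfl⟩
    · rintro ⟨b', ⟨hn, rfl⟩ | ⟨i, hb'⟩, rfl⟩
      · exact .inl ⟨hn, rfl⟩
      · exact .inr ⟨i, b', hb', rfl⟩

end LabeledTree

namespace IsProofTree

variable {S : Schema} {C : Type*} {Sig : DatalogProgram S} {D : Set (RelAtom S C)}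

theorem map (g : C → C) {T : LabeledTree (RelAtom S C)} (h : IsProofTree Sig D T) :
    IsProofTree Sig (RelAtom.map g '' D) (T.map (RelAtom.map g)) := by
  induction T with
  | node a n c ih =>
    obtain ⟨⟨ho, ha⟩, hl, hr, hc⟩ := h
    refine ⟨⟨ho, fun i => ?_⟩, fun hn => ⟨a, hl hn, rfl⟩, fun hn => ?_, fun i => ih i (hc i)⟩
    · obtain ⟨α, hα, j, hj⟩ := ha i
      exact ⟨α.map g, ⟨α, hα, rfl⟩, j, congrArg g hj⟩
    · obtain ⟨r, hrS, h, rfl, hlen, hi⟩ := hr hn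
      exact ⟨r, hrS, g ∘ h, rfl, hlen, fun i => by
        rw [LabeledTree.rootLabel_map, hi i, RelAtom.map_map]⟩

theorem rootLabel_mem_base {T : LabeledTree (RelAtom S C)} (h : IsProofTree Sig D T) :
    T.rootLabel ∈ Sig.base D := by
  cases T; exact h.1

/-- A proof tree depends only on the facts in its support: as rules are safe, all constants of its
labels occur in the support. -/
theorem of_support_subset {D' : Set (RelAtom S C)} {T : LabeledTree (RelAtom S C)}
    (h : IsProofTree Sig D T) (hD' : T.support ⊆ D') : IsProofTree Sig D' T := by
  induction T with
  | node a n c ih =>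
    obtain ⟨⟨ho, -⟩, hl, hr, hc⟩ := h
    have hc' : ∀ i, IsProofTree Sig D' (c i) := fun i =>
      ih i (hc i) fun b hb => hD' (.inr ⟨i, hb⟩)
    refine ⟨⟨ho, fun i => ?_⟩, fun hn => hD' (.inl ⟨hn, rfl⟩), hr, hc'⟩
    by_cases hn : n = 0
    · exact ⟨a, hD' (.inl ⟨hn, rfl⟩), i, rfl⟩
    · obtain ⟨r, hrS, h, rfl, rfl, hi⟩ := hr hn
      obtain ⟨α, hα, j, hj⟩ := r.safe i
      obtain ⟨m, rfl⟩ := List.get_of_mem hα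
      have hm := (hc' m).rootLabel_mem_base.2
      rw [hi m] at hm
      change h (r.head.args i) ∈ _
      rw [← hj]
      exact hm j

theorem predEdge_child {a : RelAtom S C} {n : ℕ} {c : Fin n → LabeledTree (RelAtom S C)}
    (h : IsProofTree Sig D (.node a n c)) (i : Fin n) :
    Sig.PredEdge (c i).rootLabel.rel a.rel := by
  obtain ⟨r, hrS, h, rfl, rfl, hi⟩ := h.2.2.1 (Nat.ne_zero_of_lt i.2)
  rw [hi i]
  exact ⟨r, hrS, rfl, _, List.get_mem _ _, rfl⟩

/-- In a proof tree, the predicates below a node lead to the predicate of the node in the predicate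
graph. -/
theorem reflTransGen_predEdge {T : LabeledTree (RelAtom S C)} (h : IsProofTree Sig D T) :
    ∀ b ∈ T.labels, Relation.ReflTransGen Sig.PredEdge b.rel T.rootLabel.rel := by
  induction T with
  | node a n c ih =>
    rintro b (rfl | ⟨i, hb⟩)
    · exact .refl
    · exact (ih i (h.2.2.2 i) b hb).tail (h.predEdge_child i)

/-- For a non-recursive program, all proof trees are non-recursive: a repeated label on a path would
be a directed cycle in the predicate graph. -/
theorem nonRecursive (hS : Sig.NonRecursive) {T : LabeledTree (RelAtom S C)}
    (h : IsProofTree Sig D T) : T.NonRecursive := by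
  induction T with
  | node a n c ih =>
    refine ⟨fun i ha => ?_, fun i => ih i (h.2.2.2 i)⟩
    exact hS _ (.tail' ((h.2.2.2 i).reflTransGen_predEdge a ha) (h.predEdge_child i))

end IsProofTree

namespace DatalogProgram

variable {S : Schema} {Sig : DatalogProgram S}

theorem NonRecursive.wellFounded_predEdge (hS : Sig.NonRecursive) :
    WellFounded Sig.PredEdge := by
  have := S.finite
  have : Std.Irrefl (Relation.TransGen Sig.PredEdge) := ⟨hS⟩
  exact Subrelation.wf (fun h => Relation.TransGen.single h)
    (Finite.wellFounded_of_trans_of_irrefl (Relation.TransGen Sig.PredEdge))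

/-- For a non-recursive program, the number of constants in the support of a proof tree is bounded
independently of the database, since the depth and the branching of the tree are bounded. -/
theorem NonRecursive.exists_encard_activeDomain_support_le (C : Type*) (hS : Sig.NonRecursive)
    (P : S.Rel) : ∃ B : ℕ, ∀ (D : Set (RelAtom S C)) (T : LabeledTree (RelAtom S C)),
      IsProofTree Sig D T → T.rootLabel.rel = P → (activeDomain T.support).encard ≤ B := by
  have := S.finite
  have := Fintype.ofFinite S.Rel
  induction P using hS.wellFounded_predEdge.induction with
  | _ P ih =>
    choose! B hB using ih
    refine ⟨S.arity P + (Sig.sup fun r => r.body.length) * ∑ Q, B Q, fun D T hT hP => ?_⟩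
    obtain ⟨a, n, c⟩ := T
    obtain rfl : a.rel = P := hP
    have hsub : activeDomain (LabeledTree.node a n c).support ⊆
        Set.range a.args ∪ ⋃ i, activeDomain (c i).support := by
      rintro x ⟨α, ⟨-, rfl⟩ | ⟨i, hα⟩, j, rfl⟩
      · exact .inl ⟨j, rfl⟩
      · exact .inr (Set.mem_iUnion.2 ⟨i, α, hα, j, rfl⟩)
    have hn : n ≤ Sig.sup fun r => r.body.length := by
      by_cases hn : n = 0
      · omega
      · obtain ⟨r, hrS, -, -, rfl, -⟩ := hT.2.2.1 hn
        exact Finset.le_sup (f := fun r : DatalogRule S => r.body.length) hrS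
    have hchild (i : Fin n) : (activeDomain (c i).support).encard ≤ ((∑ Q, B Q : ℕ) : ℕ∞) :=
      (hB _ (hT.predEdge_child i) D (c i) (hT.2.2.2 i) rfl).trans <| by
        exact_mod_cast Finset.single_le_sum (f := B) (fun _ _ => Nat.zero_le _)
          (Finset.mem_univ (c i).rootLabel.rel)
    calc (activeDomain (LabeledTree.node a n c).support).encard
        ≤ (Set.range a.args).encard + (⋃ i, activeDomain (c i).support).encard :=
          (Set.encard_le_encard hsub).trans (Set.encard_union_le _ _)
      _ ≤ S.arity a.rel + ∑ _i : Fin n, ((∑ Q, B Q : ℕ) : ℕ∞) := by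
          refine add_le_add ?_ ((Set.encard_iUnion_le_of_fintype _).trans
            (Finset.sum_le_sum fun i _ => hchild i))
          rw [← Set.image_univ]
          refine (Set.encard_image_le _ _).trans ?_
          simp
      _ ≤ _ := by
          rw [Finset.sum_const, Finset.card_univ, Fintype.card_fin, nsmul_eq_mul]
          exact_mod_cast Nat.add_le_add_left (Nat.mul_le_mul_right _ hn) _

end DatalogProgram

namespace DatalogQuery

variable {S : Schema} {C : Type*} (Q : DatalogQuery S)

theorem mem_whyNR_iff (hQ : Q.NonRecursive) {D : Set (RelAtom S C)}
    {t : Fin (S.arity Q.goal) → C} {E : Set (RelAtom S C)} :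
    E ∈ Q.whyNR D t ↔ ∃ T : LabeledTree (RelAtom S C),
      IsProofTree Q.prog D T ∧ T.rootLabel = ⟨Q.goal, t⟩ ∧ T.support = E :=
  ⟨fun ⟨T, hT, hr, _, hs⟩ => ⟨T, hT, hr, hs⟩,
    fun ⟨T, hT, hr, hs⟩ => ⟨T, hT, hr, hT.nonRecursive hQ, hs⟩⟩

/-! ### Patterns of explanations -/

/-- `(E₀, t₀)` is a pattern: after an injective renaming of `0, …, n - 1` to constants, `E₀` is a
support of a proof tree of `t₀` w.r.t. the database `E₀`. -/
def IsPattern (C : Type*) (n : ℕ) (E₀ : Set (RelAtom S (Fin n)))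
    (t₀ : Fin (S.arity Q.goal) → Fin n) : Prop :=
  ∃ j : Fin n → C, Function.Injective j ∧
    RelAtom.map j '' E₀ ∈ Q.whyNR (RelAtom.map j '' E₀) (fun i => j (t₀ i))

/-- Every image of a pattern is an explanation, and for some bound `M` every explanation is the image
of a pattern over at most `M` constants. The image need not be injective, since proof trees can be
mapped along arbitrary maps of constants. -/
theorem exists_mem_whyNR_iff_isPattern [Nonempty C] (hQ : Q.NonRecursive) :
    ∃ M : ℕ, ∀ (D : Set (RelAtom S C)) (t : Fin (S.arity Q.goal) → C) (E : Set (RelAtom S C)),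
      E ⊆ D → (E ∈ Q.whyNR D t ↔ ∃ (n : Fin (M + 1)) (E₀ : Set (RelAtom S (Fin n)))
        (t₀ : Fin (S.arity Q.goal) → Fin n), Q.IsPattern C n E₀ t₀ ∧
          ∃ h : Fin n → C, (∀ i, h i ∈ activeDomain D) ∧
            RelAtom.map h '' E₀ = E ∧ ∀ i, h (t₀ i) = t i) := by
  obtain ⟨M, hM⟩ := DatalogProgram.NonRecursive.exists_encard_activeDomain_support_le C hQ Q.goal
  refine ⟨M, fun D t E hED => ⟨fun hE => ?_, ?_⟩⟩
  · obtain ⟨T, hT, hr, rfl⟩ := (Q.mem_whyNR_iff hQ).1 hE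
    have hcard := hM D T hT (by rw [hr])
    have hfin : (activeDomain T.support).Finite :=
      Set.finite_of_encard_le_coe hcard
    have := hfin.to_subtype
    have hle : Nat.card (activeDomain T.support) < M + 1 := by
      rw [Nat.card_coe_set_eq, Nat.lt_succ_iff]
      rw [← hfin.cast_ncard_eq] at hcard
      exact_mod_cast hcard
    let e := (Finite.equivFin (activeDomain T.support)).symm
    let j : Fin (Nat.card (activeDomain T.support)) → C := fun i => e i
    have hj : Function.Injective j := Subtype.val_injective.comp e.injective
    have hT' := hT.of_support_subset subset_rfl
    have hsurj : ∀ c ∈ activeDomain T.support, ∃ i, j i = c := fun c hc =>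
      ⟨e.symm ⟨c, hc⟩, congrArg Subtype.val (e.apply_symm_apply ⟨c, hc⟩)⟩
    have himage : RelAtom.map j '' (RelAtom.map j ⁻¹' T.support) = T.support := by
      refine Set.image_preimage_eq_of_subset fun α hα => ?_
      choose u hu using fun i => hsurj (α.args i) ⟨α, hα, i, rfl⟩
      exact ⟨⟨α.rel, u⟩, by simp [RelAtom.map, hu]⟩
    have ht : ∀ i, t i ∈ activeDomain T.support := by
      have := hT'.rootLabel_mem_base.2
      rw [hr] at this
      exact this
    choose t₀ ht₀ using fun i => hsurj (t i) (ht i)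
    refine ⟨⟨_, hle⟩, RelAtom.map j ⁻¹' T.support, t₀, ⟨j, hj, ?_⟩, j, fun i =>
      activeDomain_mono hED (e i).2, himage, ht₀⟩
    rw [himage]
    simp only [ht₀]
    exact (Q.mem_whyNR_iff hQ).2 ⟨T, hT', hr, rfl⟩
  · rintro ⟨n, E₀, t₀, ⟨j, hj, hE₀⟩, h, -, rfl, ht⟩
    obtain ⟨T, hT, hr, hs⟩ := (Q.mem_whyNR_iff hQ).1 hE₀
    -- The map of constants that takes the renamed pattern to its image.
    let g : C → C := Function.extend j h fun _ => Classical.arbitrary C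
    have hg : ∀ i, g (j i) = h i := hj.extend_apply h _
    have hgj : g ∘ j = h := funext hg
    have himage : RelAtom.map g '' (RelAtom.map j '' E₀) = RelAtom.map h '' E₀ := by
      rw [Set.image_image]
      simp only [RelAtom.map_map, hgj]
    have hs' : (T.map (RelAtom.map g)).support = RelAtom.map h '' E₀ := by
      rw [LabeledTree.support_map, hs, himage]
    refine (Q.mem_whyNR_iff hQ).2
      ⟨_, (hT.map g).of_support_subset (hs'.trans_subset hED), ?_, hs'⟩
    rw [LabeledTree.rootLabel_map, hr]
    simp only [RelAtom.map, hg, ht]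

/-! ### The first-order sentence for the why-provenance -/

/-- `x` encodes an input: the facts of `E` are facts of `D`, each position of the tuple carries exactly
one constant, and each constant occurs in `D`. -/
def IsEncoding (N : ℕ) (x : Set (RelAtom Q.inputSchema (Fin N))) : Prop :=
  (∀ P : {P : S.Rel // Q.prog.Extensional P}, ∀ u : Fin (S.arity P.1) → Fin N,
    (⟨.inr (.inl P), u⟩ : RelAtom Q.inputSchema (Fin N)) ∈ x →
      (⟨.inl P, u⟩ : RelAtom Q.inputSchema (Fin N)) ∈ x) ∧
  (∀ i : Fin (S.arity Q.goal), ∃ u : Fin 1 → Fin N,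
    (⟨.inr (.inr i), u⟩ : RelAtom Q.inputSchema (Fin N)) ∈ x ∧
      ∀ u' : Fin 1 → Fin N,
        (⟨.inr (.inr i), u'⟩ : RelAtom Q.inputSchema (Fin N)) ∈ x → u' 0 = u 0) ∧
  ∀ c : Fin 1 → Fin N, ∃ (P : {P : S.Rel // Q.prog.Extensional P}) (j : Fin (S.arity P.1))
    (u : Fin (S.arity P.1) → Fin N),
      (⟨.inl P, u⟩ : RelAtom Q.inputSchema (Fin N)) ∈ x ∧ u j = c 0

/-- In the structure `x`, some map `h` takes the pattern `(E₀, t₀)` to the encoded facts of `E` and to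
the encoded tuple. -/
def HasMatch {n : ℕ} (E₀ : Set (RelAtom S (Fin n))) (t₀ : Fin (S.arity Q.goal) → Fin n) (N : ℕ)
    (x : Set (RelAtom Q.inputSchema (Fin N))) : Prop :=
  ∃ h : Fin n → Fin N,
    (∀ P : {P : S.Rel // Q.prog.Extensional P}, ∀ u : Fin (S.arity P.1) → Fin N,
      (⟨.inr (.inl P), u⟩ : RelAtom Q.inputSchema (Fin N)) ∈ x ↔
        ∃ α : RelAtom S (Fin n), α ∈ E₀ ∧ α.map h = ⟨P.1, u⟩) ∧
    ∀ i, (⟨.inr (.inr i), fun _ : Fin 1 => h (t₀ i)⟩ : RelAtom Q.inputSchema (Fin N)) ∈ x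

theorem foQuery_isEncoding :
    FOQuery Q.inputSchema 0 fun N x _ => Q.IsEncoding N x := by
  have := S.finite
  refine .and ?_ (.and ?_ ?_)
  · exact .forall_finite fun P => .forall_tuple _ <|
      (FOQuery.atom (V := Q.inputSchema) (.inr (.inl P)) _).imp
        (FOQuery.atom (V := Q.inputSchema) (.inl P) _)
  · exact .forall_finite fun i => .exists_tuple 1 <|
      (FOQuery.atom (V := Q.inputSchema) (.inr (.inr i)) _).and <| .forall_tuple 1 <|
        (FOQuery.atom (V := Q.inputSchema) (.inr (.inr i)) _).imp (.eq _ _)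
  · exact .forall_tuple 1 <| .exists_finite fun P => .exists_finite fun j => .exists_tuple _ <|
      (FOQuery.atom (V := Q.inputSchema) (.inl P) _).and (.eq _ _)

theorem foQuery_hasMatch {n : ℕ} (E₀ : Set (RelAtom S (Fin n)))
    (t₀ : Fin (S.arity Q.goal) → Fin n) :
    FOQuery Q.inputSchema 0 fun N x _ => Q.HasMatch E₀ t₀ N x := by
  have := S.finite
  have := RelAtom.finite (S := S) (Fin n)
  refine .exists_tuple n (.and ?_ ?_)
  · refine .forall_finite fun P => .forall_tuple _ <|
      (FOQuery.atom (V := Q.inputSchema) (.inr (.inl P)) _).iff <|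
        .exists_finite fun α => (FOQuery.const _).and ?_
    exact FOQuery.atom_eq (α.map fun i => Fin.castAdd _ (Fin.natAdd 0 i)) P.1 _
  · exact .forall_finite fun i => FOQuery.atom (V := Q.inputSchema) (.inr (.inr i)) _

end DatalogQuery

namespace DatalogQuery

variable {S : Schema} {C : Type*} (Q : DatalogQuery S)

/-! ### Encodings of inputs -/

variable {Q}

theorem IsEncoding.exists_isInput [Infinite C] {N : ℕ} {x : Set (RelAtom Q.inputSchema (Fin N))}
    (hx : Q.IsEncoding N x) :
    ∃ (ν : Fin N → C) (D : Set (RelAtom S C)) (t : Fin (S.arity Q.goal) → C)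
      (E : Set (RelAtom S C)), Q.IsInput D t E ∧ IsNumbering ν D ∧ x = Q.encode ν D t E := by
  obtain ⟨hED, ht, hdom⟩ := hx
  let ν : Fin N → C := fun i => Infinite.natEmbedding C i
  have hν : Function.Injective ν := (Infinite.natEmbedding C).injective.comp Fin.val_injective
  choose u hu hu' using ht
  let D : Set (RelAtom S C) := {α | ∃ (P : {P : S.Rel // Q.prog.Extensional P})
    (w : Fin (S.arity P.1) → Fin N), (⟨.inl P, w⟩ : RelAtom Q.inputSchema (Fin N)) ∈ x ∧
      α = ⟨P.1, fun i => ν (w i)⟩}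
  let E : Set (RelAtom S C) := {α | ∃ (P : {P : S.Rel // Q.prog.Extensional P})
    (w : Fin (S.arity P.1) → Fin N), (⟨.inr (.inl P), w⟩ : RelAtom Q.inputSchema (Fin N)) ∈ x ∧
      α = ⟨P.1, fun i => ν (w i)⟩}
  have hD : Set.range ν = activeDomain D := by
    ext c
    constructor
    · rintro ⟨i, rfl⟩
      obtain ⟨P, j, w, hw, rfl⟩ := hdom fun _ => i
      exact ⟨_, ⟨P, w, hw, rfl⟩, j, rfl⟩
    · rintro ⟨_, ⟨P, w, hw, rfl⟩, j, rfl⟩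
      exact ⟨w j, rfl⟩
  have hfin : D.Finite := by
    have := S.finite
    refine (Set.finite_range fun p : (P : {P : S.Rel // Q.prog.Extensional P}) ×
      (Fin (S.arity P.1) → Fin N) => (⟨p.1.1, fun i => ν (p.2 i)⟩ : RelAtom S C)).subset ?_
    rintro _ ⟨P, w, hw, rfl⟩
    exact ⟨⟨P, w⟩, rfl⟩
  have hinj : ∀ (P : S.Rel) (w w' : Fin (S.arity P) → Fin N),
      (⟨P, fun i => ν (w i)⟩ : RelAtom S C) = ⟨P, fun i => ν (w' i)⟩ → w = w' := by
    intro P w w' h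
    simp only [RelAtom.mk.injEq, heq_eq_eq, true_and] at h
    exact funext fun i => hν (congrFun h i)
  refine ⟨ν, D, fun i => ν (u i 0), E, ⟨⟨hfin, ?_⟩, fun i => hD ▸ ⟨_, rfl⟩, ?_⟩, ⟨hν, hD⟩, ?_⟩
  · rintro _ ⟨P, w, hw, rfl⟩
    exact P.2
  · rintro _ ⟨P, w, hw, rfl⟩
    exact ⟨P, w, hED P w hw, rfl⟩
  · ext ⟨P | P | i, w⟩
    · constructor
      · exact fun h => ⟨P, w, h, rfl⟩
      · rintro ⟨⟨P', hP'⟩, w', h, heq⟩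
        obtain ⟨P, hP⟩ := P
        obtain rfl : P = P' := congrArg RelAtom.rel heq
        rwa [hinj P w w' heq]
    · constructor
      · exact fun h => ⟨P, w, h, rfl⟩
      · rintro ⟨⟨P', hP'⟩, w', h, heq⟩
        obtain ⟨P, hP⟩ := P
        obtain rfl : P = P' := congrArg RelAtom.rel heq
        rwa [hinj P w w' heq]
    · constructor
      · exact fun h => congrArg ν (hu' i w h)
      · intro h
        obtain rfl : w = u i := funext fun k => by
          obtain rfl : k = (0 : Fin 1) := Subsingleton.elim (α := Fin 1) k 0
          exact hν h
        exact hu i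

theorem isEncoding_encode {N : ℕ} {ν : Fin N → C} {D : Set (RelAtom S C)}
    {t : Fin (S.arity Q.goal) → C} {E : Set (RelAtom S C)} (hI : Q.IsInput D t E)
    (hν : IsNumbering ν D) : Q.IsEncoding N (Q.encode ν D t E) := by
  refine ⟨fun P w h => hI.2.2 h, fun i => ?_, fun c => ?_⟩
  · obtain ⟨c, hc⟩ : t i ∈ Set.range ν := hν.2 ▸ hI.2.1 i
    exact ⟨fun _ => c, hc, fun w hw => hν.1 ((show ν (w 0) = t i from hw).trans hc.symm)⟩
  · obtain ⟨⟨P, w⟩, hα, j, hj⟩ : ν (c 0) ∈ activeDomain D := hν.2 ▸ ⟨_, rfl⟩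
    have hw : ∀ i, w i ∈ Set.range ν := fun i => hν.2 ▸ ⟨_, hα, i, rfl⟩
    choose v hv using hw
    obtain rfl : (fun i => ν (v i)) = w := funext hv
    exact ⟨⟨P, hI.1.2 _ hα⟩, j, v, hα, hν.1 hj⟩

theorem hasMatch_encode_iff {N : ℕ} {ν : Fin N → C} {D : Set (RelAtom S C)}
    {t : Fin (S.arity Q.goal) → C} {E : Set (RelAtom S C)} (hI : Q.IsInput D t E)
    (hν : IsNumbering ν D) {n : ℕ} {E₀ : Set (RelAtom S (Fin n))}
    (hE₀ : ∀ α ∈ E₀, Q.prog.Extensional α.rel) (t₀ : Fin (S.arity Q.goal) → Fin n) :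
    Q.HasMatch E₀ t₀ N (Q.encode ν D t E) ↔
      ∃ h : Fin n → C, (∀ i, h i ∈ activeDomain D) ∧ RelAtom.map h '' E₀ = E ∧
        ∀ i, h (t₀ i) = t i := by
  have hmap : Function.Injective (RelAtom.map (S := S) ν) := by
    rintro ⟨P, w⟩ ⟨P', w'⟩ h
    obtain rfl : P = P' := congrArg RelAtom.rel h
    simp only [RelAtom.map, RelAtom.mk.injEq, heq_eq_eq, true_and] at h ⊢
    exact funext fun i => hν.1 (congrFun h i)
  constructor
  · rintro ⟨h, hE, ht⟩
    refine ⟨ν ∘ h, fun i => hν.2 ▸ ⟨_, rfl⟩, ?_, ht⟩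
    ext ⟨P, w⟩
    constructor
    · rintro ⟨α, hα, hαP⟩
      rw [← hαP]
      exact (hE ⟨α.rel, hE₀ α hα⟩ (α.map h).args).2 ⟨α, hα, rfl⟩
    · intro hw
      have hrange : ∀ i, w i ∈ Set.range ν := fun i => hν.2 ▸ ⟨_, hI.2.2 hw, i, rfl⟩
      choose v hv using hrange
      obtain rfl : (fun i => ν (v i)) = w := funext hv
      obtain ⟨α, hα, hαP⟩ := (hE ⟨P, hI.1.2 _ (hI.2.2 hw)⟩ v).1 hw
      exact ⟨α, hα, by rw [← RelAtom.map_map, hαP]; rfl⟩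
  · rintro ⟨h', hD, rfl, ht⟩
    choose h hh using fun i => (hν.2 ▸ hD i : h' i ∈ Set.range ν)
    obtain rfl : ν ∘ h = h' := funext hh
    refine ⟨h, fun P w => ⟨?_, ?_⟩, fun i => ht i⟩
    · rintro ⟨α, hα, hαP⟩
      exact ⟨α, hα, hmap hαP⟩
    · rintro ⟨α, hα, hαP⟩
      exact ⟨α, hα, congrArg (RelAtom.map ν) hαP⟩

end DatalogQuery

theorem mainTheorem7 {C : Type*} [Infinite C] {S : Schema} (Q : DatalogQuery S)
    (hQ : Q.NonRecursive) : Q.WhyProvenanceNRInAC0 C := by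
  obtain ⟨M, hM⟩ := Q.exists_mem_whyNR_iff_isPattern (C := C) hQ
  -- Only patterns with extensional facts can be matched by a set of facts of a database.
  let L : StructureProblem Q.inputSchema := fun N => {x | Q.IsEncoding N x ∧
    ∃ (n : Fin (M + 1)) (E₀ : Set (RelAtom S (Fin n))) (t₀ : Fin (S.arity Q.goal) → Fin n),
      (Q.IsPattern C n E₀ t₀ ∧ ∀ α ∈ E₀, Q.prog.Extensional α.rel) ∧ Q.HasMatch E₀ t₀ N x}
  have hL : FOQuery Q.inputSchema 0 fun N x _ => x ∈ L N := by
    have := fun n => RelAtom.finite (S := S) (Fin n)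
    exact Q.foQuery_isEncoding.and <| .exists_finite fun n => .exists_finite fun E₀ =>
      .exists_finite fun t₀ => (FOQuery.const _).and (Q.foQuery_hasMatch E₀ t₀)
  obtain ⟨φ, hφ⟩ := hL
  refine ⟨L, φ.inAC0 fun N x => hφ N x _, fun N x hx => hx.1.exists_isInput, ?_⟩
  intro D t E hI N ν hν
  rw [hM D t E hI.2.2]
  constructor
  · rintro ⟨-, n, E₀, t₀, ⟨hp, hE₀⟩, hm⟩
    exact ⟨n, E₀, t₀, hp, (DatalogQuery.hasMatch_encode_iff hI hν hE₀ t₀).1 hm⟩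
  · rintro ⟨n, E₀, t₀, hp, h, hD, rfl, ht⟩
    have hE₀ : ∀ α ∈ E₀, Q.prog.Extensional α.rel := fun α hα =>
      hI.1.2 _ (hI.2.2 ⟨α, hα, rfl⟩)
    exact ⟨DatalogQuery.isEncoding_encode hI hν, n, E₀, t₀, ⟨hp, hE₀⟩,
      (DatalogQuery.hasMatch_encode_iff hI hν hE₀ t₀).2 ⟨h, hD, rfl, ht⟩⟩
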